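/- Let $1\le p\le\infty$; all Banach spaces are over the same scalar field, $\mathbb R$ or $\mathbb C$. A sequence $(x_n)$ in a Banach space $E$ is weakly $p$-summable if $(f(x_n))_n\in\ell_p$ for every $f\in E^*$ (for $p=\infty$: if it is weakly null); it is weakly $p$-convergent to $a$ if $(x_n-a)$ is weakly $p$-summable. A set $K\subset E$ is weakly $p$-compact if each sequence in $K$ has a weakly $p$-convergent subsequence and the limits of weakly $p$-convergent sequences in $K$ lie in $K$. A bounded set $K\subset E$ is Dunford–Pettis if every weakly null sequence $(f_n)$ in $E^*$ satisfies $\sup_{x\in K}|f_n(x)|\to0$. A sequence is $p$-Right null if it is weakly $p$-summable and its range is a Dunford–Pettis set. A bounded set $K\subset E$ is a $p$-Right$^*$ set if $\sup_{x\in K}|f_n(x)|\to0$ for every $p$-Right null sequence $(f_n)$ in $E^*$. $E$ has the $p$-$(SR^*)$ property if every $p$-Right$^*$ set in $E$ is relatively weakly compact. An operator (bounded linear map) is pseudo weakly compact of order $p$ if it carries Dunford–Pettis weakly $p$-compact sets to relatively norm compact sets, and weakly compact if it maps the closed unit ball to a relatively weakly compact set. Put $\hat d(K,A)=\sup_{a\in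 K}d(a,A)$ and, for bounded $K\subset E$, $$\omega(K)=\inf\{\hat d(K,A):\emptyset\ne A\subset E\text{ weakly compact}\},\qquad \vartheta_p(K)=\inf\{\hat d(K,A):\emptyset\ne A\subset E\text{ a }p\text{-Right}^*\text{ set}\};$$ for an operator $T:Y\to E$ put $\omega(T)=\omega(T(B_Y))$ and $\vartheta_p(T)=\vartheta_p(T(B_Y))$, where $B_Y$ is the closed unit ball of $Y$. **Theorem.** Let $X$ be a Banach space. The following are equivalent: (i) for every Banach space $Y$, every operator $T:Y\to X$ whose adjoint $T^*:X^*\to Y^*$ is pseudo weakly compact of order $p$ is weakly compact; (ii) every operator $T:\ell_1\to X$ whose adjoint is pseudo weakly compact of order $p$ is weakly compact; (iii) $X$ has the $p$-$(SR^*)$ property; (iv) $\omega(T)\le\vartheta_p(T)$ for every Banach space $Y$ and every operator $T:Y\to X$; (v) $\omega(K)\le\vartheta_p(K)$ for every bounded set $K\subset X$. -/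

import Mathlib

open Filter Topology ENNReal

universe v w

noncomputable section

namespace RightStar

variable (𝕜 : Type*) [RCLike 𝕜]

section Sequences

variable {E : Type*} [NormedAddCommGroup E] [NormedSpace 𝕜 E]

/-- Weakly null sequence: `f (x n) → 0` for every `f` in the dual space. -/
def WeaklyNull (x : ℕ → E) : Prop :=
  ∀ f : StrongDual 𝕜 E, Tendsto (fun n => f (x n)) atTop (𝓝 0)

/-- Weakly `p`-summable sequence: `(f (x n))` is in `ℓ_p` for every `f` in the dual space.
For `p = ∞` the usual convention applies: `c₀` takes the place of `ℓ_∞`, that is, the weakly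
`∞`-summable sequences are the weakly null ones. -/
def WeaklyPSummable (p : ℝ≥0∞) (x : ℕ → E) : Prop :=
  (p = ∞ → WeaklyNull 𝕜 x) ∧
    (p ≠ ∞ → ∀ f : StrongDual 𝕜 E, Memℓp (fun n => f (x n)) p)

/-- `(x n)` is weakly `p`-convergent to `a`. -/
def WeaklyPConvergent (p : ℝ≥0∞) (x : ℕ → E) (a : E) : Prop :=
  WeaklyPSummable 𝕜 p (fun n => x n - a)

end Sequences

section Sets

variable {E : Type*} [NormedAddCommGroup E] [NormedSpace 𝕜 E]

/-- Dunford-Pettis set: a bounded set on which every weakly null sequence of the dual space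
converges uniformly to zero. -/
def IsDunfordPettisSet (K : Set E) : Prop :=
  Bornology.IsBounded K ∧
    ∀ f : ℕ → StrongDual 𝕜 E, WeaklyNull 𝕜 f →
      TendstoUniformlyOn (fun n x => f n x) (fun _ => 0) atTop K

/-- Weakly `p`-compact set: each sequence in `K` has a weakly `p`-convergent subsequence, and the
limits of weakly `p`-convergent sequences in `K` lie in `K`. -/
def IsWeaklyPCompact (p : ℝ≥0∞) (K : Set E) : Prop :=
  (∀ x : ℕ → E, (∀ n, x n ∈ K) →
      ∃ (φ : ℕ → ℕ) (a : E), StrictMono φ ∧ WeaklyPConvergent 𝕜 p (x ∘ φ) a) ∧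
    ∀ (x : ℕ → E) (a : E), (∀ n, x n ∈ K) → WeaklyPConvergent 𝕜 p x a → a ∈ K

/-- `p`-Right null sequence: a weakly `p`-summable sequence whose range is a Dunford-Pettis set. -/
def PRightNull (p : ℝ≥0∞) (x : ℕ → E) : Prop :=
  IsDunfordPettisSet 𝕜 (Set.range x) ∧ WeaklyPSummable 𝕜 p x

/-- `p`-Right* set: a bounded set on which every `p`-Right null sequence of the dual space
converges uniformly to zero. -/
def IsPRightStarSet (p : ℝ≥0∞) (K : Set E) : Prop :=
  Bornology.IsBounded K ∧
    ∀ f : ℕ → StrongDual 𝕜 E, PRightNull 𝕜 p f →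
      TendstoUniformlyOn (fun n x => f n x) (fun _ => 0) atTop K

/-- Weakly compact set. -/
def IsWeaklyCompact (K : Set E) : Prop :=
  IsCompact (toWeakSpace 𝕜 E '' K)

/-- Relatively weakly compact set: its weak closure is weakly compact. -/
def IsRelativelyWeaklyCompact (K : Set E) : Prop :=
  IsCompact (closure (toWeakSpace 𝕜 E '' K))

/-- The `p`-sequentially Right* property. -/
def HasPSRStar (p : ℝ≥0∞) (E : Type*) [NormedAddCommGroup E] [NormedSpace 𝕜 E] : Prop :=
  ∀ K : Set E, IsPRightStarSet 𝕜 p K → IsRelativelyWeaklyCompact 𝕜 K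

/-- The non-symmetrized Hausdorff distance `sup {d(a, B) : a ∈ A}`. -/
def excess (A B : Set E) : ℝ≥0∞ :=
  ⨆ a ∈ A, Metric.infEDist a B

/-- The de Blasi measure of weak non-compactness. -/
def deBlasi (K : Set E) : ℝ≥0∞ :=
  ⨅ (A : Set E) (_ : A.Nonempty) (_ : IsWeaklyCompact 𝕜 A), excess K A

/-- The quantity `ϑ_p(K)`, the distance of `K` from the nonempty `p`-Right* sets. -/
def vartheta (p : ℝ≥0∞) (K : Set E) : ℝ≥0∞ :=
  ⨅ (A : Set E) (_ : A.Nonempty) (_ : IsPRightStarSet 𝕜 p A), excess K A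

end Sets

section Operators

variable {𝕜}
variable {E F : Type*} [NormedAddCommGroup E] [NormedSpace 𝕜 E]
  [NormedAddCommGroup F] [NormedSpace 𝕜 F]

/-- The adjoint `T* : F* → E*`, `T* f = f ∘ T`. -/
def dualOperator (T : E →L[𝕜] F) : StrongDual 𝕜 F →L[𝕜] StrongDual 𝕜 E :=
  ContinuousLinearMap.precomp 𝕜 T

theorem dualOperator_apply (T : E →L[𝕜] F) (f : StrongDual 𝕜 F) (x : E) :
    dualOperator T f x = f (T x) := rfl

/-- Weakly compact operator: the image of the closed unit ball is relatively weakly compact. -/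
def IsWeaklyCompactOperator (T : E →L[𝕜] F) : Prop :=
  IsRelativelyWeaklyCompact 𝕜 (T '' Metric.closedBall 0 1)

/-- Pseudo weakly compact operator of order `p`: it carries Dunford-Pettis weakly `p`-compact sets
to relatively norm compact sets. -/
def IsPseudoWeaklyCompactOperator (p : ℝ≥0∞) (T : E →L[𝕜] F) : Prop :=
  ∀ K : Set E, IsDunfordPettisSet 𝕜 K → IsWeaklyPCompact 𝕜 p K → IsCompact (closure (T '' K))

/-- `ω(T) = ω(T(B_E))`. -/
def deBlasiOperator (T : E →L[𝕜] F) : ℝ≥0∞ :=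
  deBlasi 𝕜 (T '' Metric.closedBall 0 1)

/-- `ϑ_p(T) = ϑ_p(T(B_E))`. -/
def varthetaOperator (p : ℝ≥0∞) (T : E →L[𝕜] F) : ℝ≥0∞ :=
  vartheta 𝕜 p (T '' Metric.closedBall 0 1)

end Operators

end RightStar

end

open RightStar

/-! The heart is a two-way link between p-Right* sets and adjoints. If T* is pseudo weakly compact
of order p, then T(B_Y) is a p-Right* set: a p-Right null (f_n), with 0 added, has a Dunford–Pettis
weakly p-compact range, so (T* f_n) lies in a norm compact set, where its only possible limit is 0
(`isPRightStarSet_image_closedBall`). Conversely, a sequence in a p-Right* set is the image of the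
unit vectors under an operator from ℓ₁. A functional on ℓ₁ has its norm controlled on the unit
vectors, so uniform convergence on the set becomes norm convergence under the adjoint
(`isPseudoWeaklyCompactOperator_dualOperator`).

Thus (ii) gives every sequence in a p-Right* set a weak cluster point, and Eberlein–Šmulian yields
(iii). Under (iii) the weak closure of a p-Right* set competes in the infimum defining ω, so (v)
holds, and (iv) with it. Under (iv), if T* is pseudo weakly compact of order p, then T(B_Y) is
itself p-Right*, so ω(T) ≤ ϑ_p(T) = 0 and Grothendieck's criterion gives (i). -/

namespace RightStar

/-! ### Eberlein–Šmulian theorem and Grothendieck's criterion -/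

section WeakTopology

variable {𝕜 : Type*} [RCLike 𝕜] {E : Type*} [NormedAddCommGroup E] [NormedSpace 𝕜 E]

open NormedSpace
open scoped Pointwise

/-- The span of a finite set of functionals is normed, up to a factor `2`, by a finite subset of
the unit ball of the predual. -/
theorem exists_finset_norming {s : Set (StrongDual 𝕜 E)} (hs : s.Finite) :
    ∃ G : Finset E, ∀ Ψ ∈ Submodule.span 𝕜 s, ∀ c : ℝ, 0 ≤ c →
      (∀ g ∈ G, ‖g‖ ≤ 1 → ‖Ψ g‖ ≤ c) → ‖Ψ‖ ≤ 2 * c := by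
  let _ : NormedSpace ℝ E := NormedSpace.restrictScalars ℝ 𝕜 E
  let F := Submodule.span 𝕜 s
  have : FiniteDimensional 𝕜 F := FiniteDimensional.span_of_finite 𝕜 hs
  have : ProperSpace F := FiniteDimensional.proper_rclike 𝕜 F
  -- Each unit functional exceeds 1/2 somewhere on the unit ball; compactness of the
  -- finite-dimensional sphere leaves finitely many such points.
  obtain ⟨t, ht⟩ := (isCompact_sphere (0 : F) 1).elim_finite_subcover
    (fun g : Metric.closedBall (0 : E) 1 => {Ψ : F | 1 / 2 < ‖(Ψ : StrongDual 𝕜 E) g‖})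
    (fun g => isOpen_lt continuous_const (by fun_prop)) (fun Ψ hΨ => by
      have h1 : ‖(Ψ : StrongDual 𝕜 E)‖ = 1 := mem_sphere_zero_iff_norm.1 hΨ
      by_contra hcon
      simp only [Set.mem_iUnion, not_exists, Set.mem_ofPred_eq, not_lt] at hcon
      have : ‖(Ψ : StrongDual 𝕜 E)‖ ≤ 1 / 2 :=
        ContinuousLinearMap.opNorm_le_of_unit_norm (by norm_num) fun x hx =>
          hcon ⟨x, by simp [hx]⟩
      linarith)
  classical
  refine ⟨t.image Subtype.val, fun Ψ hΨ c hc hG => ?_⟩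
  by_cases h0 : Ψ = 0
  · simp [h0, hc]
  have hn : 0 < ‖Ψ‖ := norm_pos_iff.2 h0
  have hmem : ((‖Ψ‖ : 𝕜)⁻¹ • (⟨Ψ, hΨ⟩ : F)) ∈ Metric.sphere (0 : F) 1 := by
    refine (mem_sphere_zero_iff_norm (E := F)).2 ?_
    rw [Submodule.coe_norm, Submodule.coe_smul, norm_smul]
    simp [hn.ne']
  have := ht hmem
  simp only [Set.mem_iUnion, Set.mem_ofPred_eq] at this
  obtain ⟨g, hg, hlt⟩ := this
  have h2 := hG g (Finset.mem_image_of_mem _ hg) (mem_closedBall_zero_iff.1 g.2)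
  have h3 : ‖((‖Ψ‖ : 𝕜)⁻¹ • Ψ) (g : E)‖ = ‖Ψ‖⁻¹ * ‖Ψ g‖ := by
    simp
  have h4 : 1 / 2 < ‖Ψ‖⁻¹ * ‖Ψ g‖ := h3 ▸ hlt
  rw [inv_mul_eq_div, lt_div_iff₀ hn] at h4
  linarith

/-- A weak cluster point of a sequence belongs to the norm-closed span of the sequence. -/
theorem mem_closure_span_of_mapClusterPt {a : ℕ → E} {x : E}
    (h : MapClusterPt (toWeakSpace 𝕜 E x) atTop fun n => toWeakSpace 𝕜 E (a n)) :
    x ∈ closure (Submodule.span 𝕜 (Set.range a) : Set E) := by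
  let _ : NormedSpace ℝ E := NormedSpace.restrictScalars ℝ 𝕜 E
  have hconv : Convex ℝ (Submodule.span 𝕜 (Set.range a) : Set E) :=
    ((Submodule.span 𝕜 (Set.range a)).restrictScalars ℝ).convex
  have hx : toWeakSpace 𝕜 E x ∈
      closure (toWeakSpace 𝕜 E '' (Submodule.span 𝕜 (Set.range a) : Set E)) := by
    refine mem_closure_iff_clusterPt.2 (h.clusterPt.mono ?_)
    rw [le_principal_iff]
    exact Filter.mem_map.2 (Filter.univ_mem' fun n =>
      ⟨a n, Submodule.subset_span (Set.mem_range_self n), rfl⟩)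
  rw [← hconv.toWeakSpace_closure 𝕜] at hx
  obtain ⟨y, hy, hyx⟩ := hx
  rwa [← (toWeakSpace 𝕜 E).injective hyx]

theorem exists_mem_forall_norm_sub_lt_of_mem_closure {K : Set E}
    {Φ : StrongDual 𝕜 (StrongDual 𝕜 E)}
    (hΦ : StrongDual.toWeakDual Φ ∈
      closure (inclusionInDoubleDualWeak 𝕜 E '' (toWeakSpace 𝕜 E '' K)))
    (G : Finset (StrongDual 𝕜 E)) {ε : ℝ} (hε : 0 < ε) :
    ∃ x ∈ K, ∀ f ∈ G, ‖Φ f - f x‖ < ε := by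
  have hopen : IsOpen {Ψ : WeakDual 𝕜 (StrongDual 𝕜 E) | ∀ f ∈ G, ‖Φ f - Ψ f‖ < ε} := by
    have : {Ψ : WeakDual 𝕜 (StrongDual 𝕜 E) | ∀ f ∈ G, ‖Φ f - Ψ f‖ < ε} =
        ⋂ f ∈ G, {Ψ : WeakDual 𝕜 (StrongDual 𝕜 E) | ‖Φ f - Ψ f‖ < ε} := by
      ext; simp
    rw [this]
    exact isOpen_biInter_finset fun f _ =>
      isOpen_lt (continuous_const.sub (WeakDual.eval_continuous f)).norm continuous_const
  obtain ⟨_, h1, _, ⟨x, hx, rfl⟩, rfl⟩ := mem_closure_iff.1 hΦ _ hopen (by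
    intro f _
    simpa using hε)
  exact ⟨x, hx, h1⟩

theorem sub_mem_span_insert_image {W : Type*} [NormedAddCommGroup W] [NormedSpace 𝕜 W]
    (J : E →L[𝕜] W) (Φ : W) {s : Set E} {y : E} (hy : y ∈ Submodule.span 𝕜 s) :
    Φ - J y ∈ Submodule.span 𝕜 (insert Φ (J '' s)) := by
  refine Submodule.sub_mem _ (Submodule.subset_span (Set.mem_insert _ _)) ?_
  refine Submodule.span_mono (Set.subset_insert _ _) ?_
  have : J y ∈ (Submodule.span 𝕜 s).map J.toLinearMap := Submodule.mem_map_of_mem hy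
  rwa [Submodule.map_span] at this

/-- Whitley's argument for the Eberlein–Šmulian theorem: a functional `Φ` that is a weak-* limit
point of the image of `K` belongs to the range of `J`, if each sequence in `K` has a suitable
cluster point. -/
theorem exists_eq_of_forall_finset_approx {D : Type*} [NormedAddCommGroup D] [NormedSpace 𝕜 D]
    (J : E →L[𝕜] StrongDual 𝕜 D) (hJ : ∀ x, ‖J x‖ ≤ ‖x‖) {K : Set E} {Φ : StrongDual 𝕜 D}
    (hΦ : ∀ (G : Finset D) (ε : ℝ), 0 < ε → ∃ x ∈ K, ∀ f ∈ G, ‖Φ f - J x f‖ < ε)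
    (h : ∀ a : ℕ → E, (∀ n, a n ∈ K) → ∃ x ∈ closure (Submodule.span 𝕜 (Set.range a) : Set E),
      ∀ f : D, MapClusterPt (J x f) atTop fun n => J (a n) f) :
    ∃ x, Φ = J x := by
  classical
  choose G hG using fun s : Finset E =>
    exists_finset_norming (𝕜 := 𝕜) ((s.finite_toSet.image J).insert Φ)
  -- `G` need not be monotone; the union over all subsets of `s` keeps every earlier norming set in
  -- play at later stages.
  choose c hcK hc using fun (n : ℕ) (s : Finset E) =>
    hΦ (s.powerset.biUnion G)
      (1 / ((n : ℝ) + 1)) (by positivity)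
  obtain ⟨S, hS⟩ : ∃ S : ℕ → Finset E, ∀ n, S (n + 1) = insert (c n (S n)) (S n) :=
    ⟨fun n => Nat.rec ∅ (fun n s => insert (c n s) s) n, fun _ => rfl⟩
  have hmono : Monotone S := monotone_nat_of_le_succ fun n => by
    rw [hS]; exact Finset.subset_insert _ _
  obtain ⟨a, ha⟩ : ∃ a : ℕ → E, ∀ n, a n = c n (S n) := ⟨_, fun _ => rfl⟩
  obtain ⟨x, hxcl, hx⟩ := h a fun n => ha n ▸ hcK n (S n)
  have hzero : ∀ m, ∀ g ∈ G (S m), Φ g = J x g := by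
    intro m g hg
    have hlim : Tendsto (fun n => J (a n) g) atTop (𝓝 (Φ g)) := by
      rw [tendsto_iff_norm_sub_tendsto_zero]
      refine squeeze_zero' (Eventually.of_forall fun n => norm_nonneg _) ?_
        (tendsto_one_div_add_atTop_nhds_zero_nat (𝕜 := ℝ))
      filter_upwards [eventually_ge_atTop m] with n hn
      rw [norm_sub_rev, ha]
      exact (hc n (S n) g (Finset.mem_biUnion.2
        ⟨S m, Finset.mem_powerset.2 (hmono hn), hg⟩)).le
    by_contra hne
    obtain ⟨U, V, hU, hV, hUV⟩ := t2_separation_nhds hne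
    obtain ⟨n, hn1, hn2⟩ := ((mapClusterPt_iff_frequently.1 (hx g) V hV).and_eventually
      (hlim hU)).exists
    exact Set.disjoint_left.1 hUV hn2 hn1
  -- Approximate x by y in the span of some `S n`. On `G (S n)` the functionals Φ and J x agree, so
  -- Φ - J y is at most ε there and 2ε in norm; passing from y to x costs another ε.
  have key : ∀ ε : ℝ, 0 < ε → ‖Φ - J x‖ ≤ 3 * ε := by
    intro ε hε
    obtain ⟨y, hy, hxy⟩ := Metric.mem_closure_iff.1 hxcl ε hε
    obtain ⟨T, hT, hyT⟩ := Submodule.mem_span_finite_of_mem_span hy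
    obtain ⟨n, hn⟩ : ∃ n, T ⊆ S n := by
      rw [← Set.image_univ, Finset.subset_set_image_iff] at hT
      obtain ⟨t, -, rfl⟩ := hT
      -- The term `a i` enters only at stage i + 1.
      refine ⟨t.sup id + 1, fun z hz => ?_⟩
      obtain ⟨i, hi, rfl⟩ := Finset.mem_image.1 hz
      have hi' : i + 1 ≤ t.sup id + 1 := by
        have := Finset.le_sup (f := id) hi
        simpa using this
      exact hmono hi' (by rw [hS, ← ha]; exact Finset.mem_insert_self _ _)
    have hJxy : ‖J x - J y‖ ≤ ε := by
      rw [← map_sub]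
      exact (hJ _).trans (by rw [← dist_eq_norm]; exact hxy.le)
    have hmem := sub_mem_span_insert_image J Φ
      (Submodule.span_mono (Finset.coe_subset.2 hn) hyT)
    have h2 : ‖Φ - J y‖ ≤ 2 * ε := hG (S n) _ hmem ε hε.le fun g hg hg1 => by
      have : (Φ - J y) g = (J x - J y) g := by
        simp [hzero n g hg]
      rw [this]
      exact ((J x - J y).le_of_opNorm_le hJxy g).trans (by nlinarith)
    have h3 : ‖Φ - J x‖ ≤ ‖Φ - J y‖ + ‖J x - J y‖ := by
      simpa only [dist_eq_norm] using dist_triangle_right Φ (J x) (J y)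
    linarith
  have h0 : Φ = J x := by
    rw [← sub_eq_zero, ← norm_le_zero_iff]
    refine le_of_forall_pos_le_add fun ε hε => ?_
    have := key (ε / 3) (by positivity)
    linarith
  exact ⟨x, h0⟩

/-- The **Eberlein–Šmulian theorem**: a bounded set is relatively weakly compact as soon as each of
its sequences has a weak cluster point. -/
theorem isRelativelyWeaklyCompact_of_mapClusterPt {K : Set E} (hb : Bornology.IsBounded K)
    (h : ∀ a : ℕ → E, (∀ n, a n ∈ K) →
      ∃ x : E, MapClusterPt (toWeakSpace 𝕜 E x) atTop fun n => toWeakSpace 𝕜 E (a n)) :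
    IsRelativelyWeaklyCompact 𝕜 K := by
  refine isCompact_closure_of_isBounded 𝕜 E _
    (by rwa [(toWeakSpace 𝕜 E).injective.preimage_image]) fun Φ' hΦ => ?_
  obtain ⟨Φ, rfl⟩ := StrongDual.toWeakDual.surjective Φ'
  let J := inclusionInDoubleDual 𝕜 E
  obtain ⟨x, rfl⟩ := exists_eq_of_forall_finset_approx (inclusionInDoubleDual 𝕜 E)
    (double_dual_bound 𝕜 E) (K := K) (Φ := Φ)
    (fun G ε hε => exists_mem_forall_norm_sub_lt_of_mem_closure hΦ G hε) fun a ha => by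
      obtain ⟨x, hx⟩ := h a ha
      exact ⟨x, mem_closure_span_of_mapClusterPt hx, fun f =>
        hx.continuousAt_comp
          (WeakBilin.eval_continuous (topDualPairing 𝕜 E).flip f).continuousAt⟩
  exact ⟨toWeakSpace 𝕜 E x, rfl⟩

theorem exists_eq_of_forall_norm_sub_le [CompleteSpace E] {D : Type*}
    [NormedAddCommGroup D] [NormedSpace 𝕜 D] (J : E →ₗᵢ[𝕜] StrongDual 𝕜 D) {z : StrongDual 𝕜 D}
    (h : ∀ ε : ℝ, 0 < ε → ∃ y, ‖z - J y‖ ≤ ε) : ∃ y, J y = z := by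
  have hcl : IsClosed (Set.range J) := J.isometry.isClosedEmbedding.isClosed_range
  suffices hz : z ∈ closure (Set.range J) by rwa [hcl.closure_eq] at hz
  refine Metric.mem_closure_iff.2 fun ε hε => ?_
  obtain ⟨y, hy⟩ := h (ε / 2) (by positivity)
  exact ⟨J y, ⟨y, rfl⟩, by rw [dist_eq_norm]; linarith⟩

/-- In the weak-* topology, distance estimates to a compact set pass to the closure. -/
theorem exists_norm_sub_le_of_mem_closure {A K : Set (WeakDual 𝕜 E)} (hA : IsCompact A) {r : ℝ}
    (h : ∀ x ∈ K, ∃ y ∈ A, ‖WeakDual.toStrongDual (x - y)‖ ≤ r) {x : WeakDual 𝕜 E}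
    (hx : x ∈ closure K) : ∃ y ∈ A, ‖WeakDual.toStrongDual (x - y)‖ ≤ r := by
  have hC := (hA.add (WeakDual.isCompact_closedBall (𝕜 := 𝕜) (E := E) 0 r)).isClosed
  obtain ⟨y, hy, z, hz, rfl⟩ := closure_minimal (fun x hx => by
    obtain ⟨y, hy, hxy⟩ := h x hx
    exact ⟨y, hy, x - y, mem_closedBall_zero_iff.2 hxy, add_sub_cancel _ _⟩) hC hx
  refine ⟨y, hy, ?_⟩
  rw [add_sub_cancel_left]
  exact mem_closedBall_zero_iff.1 hz

/-- A weakly compact A stays weak-* compact in the bidual, so its r-neighbourhood there is weak-*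
closed and captures the whole weak-* closure of K. -/
theorem exists_norm_sub_le_of_deBlasi_lt {K : Set E} {r : ℝ}
    (h : deBlasi 𝕜 K < ENNReal.ofReal r) {Φ : StrongDual 𝕜 (StrongDual 𝕜 E)}
    (hΦ : StrongDual.toWeakDual Φ ∈
      closure (inclusionInDoubleDualWeak 𝕜 E '' (toWeakSpace 𝕜 E '' K))) :
    ∃ y, ‖Φ - inclusionInDoubleDualLi 𝕜 y‖ ≤ r := by
  simp only [deBlasi, iInf_lt_iff] at h
  obtain ⟨A, -, hA, hKA⟩ := h
  have h1 : ∀ x ∈ K, ∃ y ∈ A, ‖x - y‖ ≤ r := fun x hx => by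
    have h1 : Metric.infEDist x A < ENNReal.ofReal r :=
      (le_iSup₂ (f := fun x (_ : x ∈ K) => Metric.infEDist x A) x hx).trans_lt hKA
    obtain ⟨y, hy, hxy⟩ := Metric.infEDist_lt_iff.1 h1
    rw [edist_lt_ofReal, dist_eq_norm] at hxy
    exact ⟨y, hy, hxy.le⟩
  have h2 : ∀ z ∈ inclusionInDoubleDualWeak 𝕜 E '' (toWeakSpace 𝕜 E '' K),
      ∃ w ∈ inclusionInDoubleDualWeak 𝕜 E '' (toWeakSpace 𝕜 E '' A),
        ‖WeakDual.toStrongDual (z - w)‖ ≤ r := by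
    rintro _ ⟨_, ⟨x, hx, rfl⟩, rfl⟩
    obtain ⟨y, hy, hxy⟩ := h1 x hx
    refine ⟨_, ⟨_, ⟨y, hy, rfl⟩, rfl⟩, ?_⟩
    have h3 : WeakDual.toStrongDual (inclusionInDoubleDualWeak 𝕜 E (toWeakSpace 𝕜 E x) -
        inclusionInDoubleDualWeak 𝕜 E (toWeakSpace 𝕜 E y)) = inclusionInDoubleDual 𝕜 E (x - y) :=
      ContinuousLinearMap.ext fun f => (map_sub f x y).symm
    rw [h3]
    exact (double_dual_bound 𝕜 E (x - y)).trans hxy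
  obtain ⟨_, ⟨_, ⟨y, -, rfl⟩, rfl⟩, hy⟩ := exists_norm_sub_le_of_mem_closure
    (hA.image (inclusionInDoubleDualWeak 𝕜 E).continuous) h2 hΦ
  exact ⟨y, hy⟩

/-- Grothendieck's criterion: a bounded subset of a Banach space that lies within every positive
distance of some weakly compact set is relatively weakly compact. -/
theorem isRelativelyWeaklyCompact_of_deBlasi_eq_zero [CompleteSpace E] {K : Set E}
    (hb : Bornology.IsBounded K) (h : deBlasi 𝕜 K = 0) : IsRelativelyWeaklyCompact 𝕜 K := by
  refine isCompact_closure_of_isBounded 𝕜 E _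
    (by rwa [(toWeakSpace 𝕜 E).injective.preimage_image]) fun Φ' hΦ => ?_
  obtain ⟨Φ, rfl⟩ := StrongDual.toWeakDual.surjective Φ'
  have key : ∀ ε : ℝ, 0 < ε → ∃ y, ‖Φ - inclusionInDoubleDualLi 𝕜 y‖ ≤ ε := fun ε hε =>
    exists_norm_sub_le_of_deBlasi_lt (by rw [h]; exact ENNReal.ofReal_pos.2 hε) hΦ
  obtain ⟨y, hy⟩ := exists_eq_of_forall_norm_sub_le _ key
  exact ⟨toWeakSpace 𝕜 E y, congrArg StrongDual.toWeakDual hy⟩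

end WeakTopology

/-! ### Weakly p-summable sequences and Dunford–Pettis sets -/

section WeaklyPSummable

variable {𝕜 : Type*} [RCLike 𝕜] {E : Type*} [NormedAddCommGroup E] [NormedSpace 𝕜 E]

theorem toReal_pos_of_one_le {p : ℝ≥0∞} (hp : 1 ≤ p) (hp' : p ≠ ∞) : 0 < p.toReal :=
  ENNReal.toReal_pos (zero_lt_one.trans_le hp).ne' hp'

theorem WeaklyPSummable.weaklyNull {p : ℝ≥0∞} (hp : 1 ≤ p) {x : ℕ → E}
    (hx : WeaklyPSummable 𝕜 p x) : WeaklyNull 𝕜 x := by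
  by_cases hp' : p = ∞
  · exact hx.1 hp'
  intro f
  have hpos := toReal_pos_of_one_le hp hp'
  have h := ((memℓp_gen_iff hpos).1 (hx.2 hp' f)).tendsto_atTop_zero
  have h2 := h.rpow_const (p := p.toReal⁻¹) (Or.inr (inv_nonneg.2 hpos.le))
  rw [Real.zero_rpow (inv_ne_zero hpos.ne')] at h2
  rw [tendsto_zero_iff_norm_tendsto_zero]
  simpa only [Real.rpow_rpow_inv (norm_nonneg _) hpos.ne'] using h2

theorem weaklyPSummable_zero {p : ℝ≥0∞} : WeaklyPSummable 𝕜 p (fun _ : ℕ => (0 : E)) :=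
  ⟨fun _ f => by simp, fun _ f => by
    simp only [map_zero]
    exact zero_memℓp (E := fun _ : ℕ => 𝕜)⟩

theorem WeaklyPSummable.comp_strictMono {p : ℝ≥0∞} (hp : 1 ≤ p) {x : ℕ → E}
    (hx : WeaklyPSummable 𝕜 p x) {φ : ℕ → ℕ} (hφ : StrictMono φ) :
    WeaklyPSummable 𝕜 p (x ∘ φ) := by
  refine ⟨fun h f => (hx.1 h f).comp hφ.tendsto_atTop, fun h f => ?_⟩
  have hpos := toReal_pos_of_one_le hp h
  exact (memℓp_gen_iff hpos).2
    (((memℓp_gen_iff hpos).1 (hx.2 h f)).comp_injective hφ.injective)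

/-- Weak `p`-summability does not depend on the first term. -/
theorem weaklyPSummable_of_succ {p : ℝ≥0∞} (hp : 1 ≤ p) {x : ℕ → E}
    (hx : WeaklyPSummable 𝕜 p (fun n => x (n + 1))) : WeaklyPSummable 𝕜 p x := by
  refine ⟨fun h f => (tendsto_add_atTop_iff_nat 1).1 (hx.1 h f), fun h f => ?_⟩
  have hpos := toReal_pos_of_one_le hp h
  exact (memℓp_gen_iff hpos).2
    ((summable_nat_add_iff 1).1 ((memℓp_gen_iff hpos).1 (hx.2 h f)))

/-- Weak limits are unique. -/
theorem WeaklyNull.eq_of_sub {x : ℕ → E} {a b : E} (ha : WeaklyNull 𝕜 fun n => x n - a)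
    (hb : WeaklyNull 𝕜 fun n => x n - b) : a = b := by
  refine (SeparatingDual.eq_iff_forall_dual_eq (R := 𝕜)).2 fun f => ?_
  have h1 := (ha f).sub (hb f)
  have h2 : ∀ n, f (x n - a) - f (x n - b) = f b - f a := fun n => by
    simp only [map_sub]
    ring
  simp only [h2, sub_self] at h1
  exact (sub_eq_zero.1 (tendsto_nhds_unique tendsto_const_nhds h1)).symm

/-- A sequence in the range of a weakly `p`-summable sequence, with `0` in the range, has a
subsequence that is weakly `p`-convergent to a point of the range. -/
theorem exists_subseq_weaklyPConvergent {p : ℝ≥0∞} (hp : 1 ≤ p) {x : ℕ → E}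
    (hx : WeaklyPSummable 𝕜 p x) (h0 : 0 ∈ Set.range x) {y : ℕ → E}
    (hy : ∀ n, y n ∈ Set.range x) :
    ∃ (φ : ℕ → ℕ) (a : E), StrictMono φ ∧ a ∈ Set.range x ∧ WeaklyPConvergent 𝕜 p (y ∘ φ) a := by
  choose k hk using hy
  -- Either some index recurs infinitely often, giving a constant subsequence, or the indices tend
  -- to infinity and a subsequence of `y` is a subsequence of `x`.
  by_cases h : ∃ m, ∃ᶠ n in atTop, k n = m
  · obtain ⟨m, hm⟩ := h
    obtain ⟨φ, hφ, hφm⟩ := extraction_of_frequently_atTop hm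
    refine ⟨φ, x m, hφ, Set.mem_range_self m, ?_⟩
    have : (fun n => (y ∘ φ) n - x m) = fun _ => 0 := by
      funext n
      simp [← hk, hφm]
    rw [WeaklyPConvergent, this]
    exact weaklyPSummable_zero
  · simp only [not_exists, not_frequently] at h
    have hkt : Tendsto k atTop atTop := by
      refine tendsto_atTop.2 fun b => ?_
      have : ∀ᶠ n in atTop, ∀ m ∈ Finset.range b, k n ≠ m :=
        (Finset.eventually_all _).2 fun m _ => h m
      filter_upwards [this] with n hn
      by_contra hlt
      exact hn (k n) (Finset.mem_range.2 (not_le.1 hlt)) rfl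
    obtain ⟨φ, hφ, hkφ⟩ := strictMono_subseq_of_tendsto_atTop hkt
    refine ⟨φ, 0, hφ, h0, ?_⟩
    have : (fun n => (y ∘ φ) n - 0) = x ∘ (k ∘ φ) := by
      funext n
      simp [← hk]
    rw [WeaklyPConvergent, this]
    exact hx.comp_strictMono hp hkφ

theorem isWeaklyPCompact_range {p : ℝ≥0∞} (hp : 1 ≤ p) {x : ℕ → E}
    (hx : WeaklyPSummable 𝕜 p x) (h0 : 0 ∈ Set.range x) :
    IsWeaklyPCompact 𝕜 p (Set.range x) := by
  refine ⟨fun y hy => ?_, fun y a hy ha => ?_⟩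
  · obtain ⟨φ, a, hφ, -, h⟩ := exists_subseq_weaklyPConvergent hp hx h0 hy
    exact ⟨φ, a, hφ, h⟩
  · obtain ⟨φ, b, hφ, hb, h⟩ := exists_subseq_weaklyPConvergent hp hx h0 hy
    have h1 : WeaklyNull 𝕜 fun n => (y ∘ φ) n - a :=
      WeaklyPSummable.weaklyNull hp (WeaklyPSummable.comp_strictMono hp ha hφ)
    rwa [h1.eq_of_sub (WeaklyPSummable.weaklyNull hp h)]

theorem IsDunfordPettisSet.insert_zero {K : Set E} (hK : IsDunfordPettisSet 𝕜 K) :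
    IsDunfordPettisSet 𝕜 (insert 0 K) := by
  refine ⟨Bornology.isBounded_insert.2 hK.1, fun f hf => ?_⟩
  rw [Metric.tendstoUniformlyOn_iff]
  intro ε hε
  filter_upwards [Metric.tendstoUniformlyOn_iff.1 (hK.2 f hf) ε hε] with n hn
  rintro x (rfl | hx)
  · simpa using hε
  · exact hn x hx

/-- A weakly `p`-convergent sequence in a Dunford-Pettis set differs from its limit by a `p`-Right
null sequence, if the limit is in the set. -/
theorem IsDunfordPettisSet.pRightNull_sub {p : ℝ≥0∞} {K : Set E} (hK : IsDunfordPettisSet 𝕜 K)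
    {x : ℕ → E} {a : E} (hx : ∀ n, x n ∈ K) (ha : a ∈ K) (h : WeaklyPConvergent 𝕜 p x a) :
    PRightNull 𝕜 p fun n => x n - a := by
  refine ⟨⟨?_, fun f hf => ?_⟩, h⟩
  · obtain ⟨C, hC⟩ := hK.1.exists_norm_le
    refine isBounded_iff_forall_norm_le.2 ⟨C + C, ?_⟩
    rintro _ ⟨n, rfl⟩
    exact (norm_sub_le _ _).trans (add_le_add (hC _ (hx n)) (hC _ ha))
  · rw [Metric.tendstoUniformlyOn_iff]
    intro ε hε
    filter_upwards [Metric.tendstoUniformlyOn_iff.1 (hK.2 f hf) (ε / 2) (by positivity)] with n hn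
    rintro _ ⟨m, rfl⟩
    have h1 := hn _ (hx m)
    have h2 := hn _ ha
    simp only [dist_zero_left, map_sub] at h1 h2 ⊢
    exact (norm_sub_le _ _).trans_lt (by linarith)

end WeaklyPSummable

/-! ### Adjoints, p-Right* sets and operators on ℓ₁ -/

section Operators

variable {𝕜 : Type*} [RCLike 𝕜] {E F G : Type*} [NormedAddCommGroup E] [NormedSpace 𝕜 E]
  [NormedAddCommGroup F] [NormedSpace 𝕜 F] [NormedAddCommGroup G] [NormedSpace 𝕜 G]

theorem IsPseudoWeaklyCompactOperator.clm_comp {p : ℝ≥0∞} {T : E →L[𝕜] F}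
    (hT : IsPseudoWeaklyCompactOperator p T) (L : F →L[𝕜] G) :
    IsPseudoWeaklyCompactOperator p (L.comp T) := fun K hK hK' => by
  refine ((hT K hK hK').image L.continuous).closure_of_subset ?_
  rintro _ ⟨x, hx, rfl⟩
  exact ⟨T x, subset_closure ⟨x, hx, rfl⟩, rfl⟩

/-- In a metric space, a set whose sequences have convergent subsequences is relatively compact. -/
theorem isCompact_closure_of_forall_seq {α : Type*} [PseudoMetricSpace α] {s : Set α}
    (h : ∀ x : ℕ → α, (∀ n, x n ∈ s) → ∃ (φ : ℕ → ℕ) (a : α), StrictMono φ ∧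
      Tendsto (x ∘ φ) atTop (𝓝 a)) : IsCompact (closure s) := by
  refine IsSeqCompact.isCompact fun y hy => ?_
  choose x hxs hxy using fun n : ℕ =>
    Metric.mem_closure_iff.1 (hy n) (1 / ((n : ℝ) + 1)) (by positivity)
  obtain ⟨φ, a, hφ, hlim⟩ := h x hxs
  have hd : Tendsto (fun n => dist (y n) (x n)) atTop (𝓝 0) :=
    squeeze_zero (fun _ => dist_nonneg) (fun n => (hxy n).le)
      (tendsto_one_div_add_atTop_nhds_zero_nat (𝕜 := ℝ))
  have hy' : Tendsto (y ∘ φ) atTop (𝓝 a) :=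
    (tendsto_iff_of_dist (hd.comp hφ.tendsto_atTop)).2 hlim
  exact ⟨a, isClosed_closure.mem_of_tendsto hy' (Eventually.of_forall fun n => hy _), φ, hφ, hy'⟩

/-- If the adjoint of `T` is pseudo weakly compact of order `p`, then `T` maps the unit ball to a
`p`-Right* set. -/
theorem isPRightStarSet_image_closedBall {p : ℝ≥0∞} (hp : 1 ≤ p) {T : E →L[𝕜] F}
    (hT : IsPseudoWeaklyCompactOperator p (dualOperator T)) :
    IsPRightStarSet 𝕜 p (T '' Metric.closedBall 0 1) := by
  refine ⟨T.lipschitz.isBounded_image Metric.isBounded_closedBall, fun f hf => ?_⟩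
  -- Prepending 0 puts the weak limit into the range, as weak p-compactness requires.
  let g : ℕ → StrongDual 𝕜 F := fun n => Nat.casesOn n 0 f
  have hrange : Set.range g = insert 0 (Set.range f) := by
    ext z
    constructor
    · rintro ⟨_ | n, rfl⟩
      · exact Or.inl rfl
      · exact Or.inr ⟨n, rfl⟩
    · rintro (rfl | ⟨n, rfl⟩)
      · exact ⟨0, rfl⟩
      · exact ⟨n + 1, rfl⟩
  have hg : WeaklyPSummable 𝕜 p g := weaklyPSummable_of_succ hp hf.2
  have hcomp : IsCompact (closure (dualOperator T '' Set.range g)) :=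
    hT _ (hrange ▸ hf.1.insert_zero) (isWeaklyPCompact_range hp hg ⟨0, rfl⟩)
  have hmem : ∀ n, dualOperator T (f n) ∈ closure (dualOperator T '' Set.range g) := fun n =>
    subset_closure ⟨f n, ⟨n + 1, rfl⟩, rfl⟩
  have hnull := hf.2.weaklyNull hp
  have hlim : Tendsto (fun n => dualOperator T (f n)) atTop (𝓝 0) := by
    refine tendsto_of_subseq_tendsto fun ns hns => ?_
    obtain ⟨L, -, φ, hφ, hL⟩ := hcomp.tendsto_subseq fun n => hmem (ns n)
    -- Norm limits are pointwise limits, and (f_n) tends to 0 at each point T y.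
    have hL0 : L = 0 := by
      ext y
      have h1 : Tendsto (fun n => (dualOperator T (f (ns (φ n)))) y) atTop (𝓝 (L y)) :=
        ((ContinuousLinearMap.apply 𝕜 𝕜 y).continuous.tendsto L).comp hL
      have h2 : Tendsto (fun n => (dualOperator T (f (ns (φ n)))) y) atTop (𝓝 0) :=
        (hnull (NormedSpace.inclusionInDoubleDual 𝕜 F (T y))).comp
          (hns.comp hφ.tendsto_atTop)
      exact tendsto_nhds_unique h1 h2
    exact ⟨φ, hL0 ▸ hL⟩
  rw [Metric.tendstoUniformlyOn_iff]
  intro ε hε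
  have hev := (tendsto_zero_iff_norm_tendsto_zero.1 hlim).eventually_lt_const hε
  filter_upwards [hev] with n hn
  rintro _ ⟨y, hy, rfl⟩
  rw [dist_zero_left]
  have hy1 : ‖y‖ ≤ 1 := mem_closedBall_zero_iff.1 hy
  exact ((dualOperator T (f n)).unit_le_opNorm y hy1).trans_lt hn

/-- The operator `ℓ₁ → E` that maps the unit vectors to a given bounded sequence. -/
theorem exists_clm_lp_one [CompleteSpace E] {x : ℕ → E} {C : ℝ} (hC : ∀ n, ‖x n‖ ≤ C) :
    ∃ T : lp (fun _ : ℕ => 𝕜) 1 →L[𝕜] E, ∀ c, HasSum (fun n => c n • x n) (T c) := by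
  have hnorm : ∀ c : lp (fun _ : ℕ => 𝕜) 1, HasSum (fun n => ‖c n‖) ‖c‖ := fun c => by
    simpa using lp.hasSum_norm (p := 1) (by simp) c
  have hle : ∀ (c : lp (fun _ : ℕ => 𝕜) 1) n, ‖c n • x n‖ ≤ C * ‖c n‖ := fun c n => by
    rw [norm_smul, mul_comm]
    exact mul_le_mul_of_nonneg_right (hC n) (norm_nonneg _)
  have hsum : ∀ c : lp (fun _ : ℕ => 𝕜) 1, Summable fun n => c n • x n := fun c =>
    Summable.of_norm_bounded ((hnorm c).summable.mul_left C) (hle c)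
  let L : lp (fun _ : ℕ => 𝕜) 1 →ₗ[𝕜] E :=
    { toFun := fun c => ∑' n, c n • x n
      map_add' := fun c d => by
        rw [← (hsum c).tsum_add (hsum d)]
        simp [add_smul]
      map_smul' := fun r c => by
        rw [RingHom.id_apply, ← (hsum c).tsum_const_smul r]
        simp [mul_smul] }
  exact ⟨L.mkContinuous C fun c => tsum_of_norm_bounded ((hnorm c).mul_left C) (hle c),
    fun c => (hsum c).hasSum⟩

theorem norm_le_of_hasSum_smul {x : ℕ → 𝕜} {T : StrongDual 𝕜 (lp (fun _ : ℕ => 𝕜) 1)}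
    (hT : ∀ c, HasSum (fun n => c n • x n) (T c)) {C : ℝ} (hC : 0 ≤ C) (hx : ∀ n, ‖x n‖ ≤ C) :
    ‖T‖ ≤ C := by
  refine T.opNorm_le_bound hC fun c => ?_
  have hnorm : HasSum (fun n => ‖c n‖) ‖c‖ := by
    simpa using lp.hasSum_norm (p := 1) (by simp) c
  rw [← (hT c).tsum_eq]
  refine tsum_of_norm_bounded (hnorm.mul_left C) fun n => ?_
  rw [norm_smul, mul_comm]
  exact mul_le_mul_of_nonneg_right (hx n) (norm_nonneg _)

/-- The operator `ℓ₁ → E` that maps the unit vectors into a `p`-Right* set has a pseudo weakly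
compact adjoint of order `p`. -/
theorem isPseudoWeaklyCompactOperator_dualOperator {p : ℝ≥0∞} {K : Set E}
    (hK : IsPRightStarSet 𝕜 p K) {x : ℕ → E} (hx : ∀ n, x n ∈ K)
    {T : lp (fun _ : ℕ => 𝕜) 1 →L[𝕜] E} (hT : ∀ c, HasSum (fun n => c n • x n) (T c)) :
    IsPseudoWeaklyCompactOperator p (dualOperator T) := by
  intro A hA hA'
  refine isCompact_closure_of_forall_seq fun z hz => ?_
  choose f hfA hfz using hz
  obtain ⟨φ, a, hφ, ha⟩ := hA'.1 f hfA
  have haA : a ∈ A := hA'.2 (f ∘ φ) a (fun n => hfA _) ha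
  have hnull : PRightNull 𝕜 p fun n => (f ∘ φ) n - a := hA.pRightNull_sub (fun n => hfA _) haA ha
  refine ⟨φ, dualOperator T a, hφ, ?_⟩
  rw [Metric.tendsto_nhds]
  intro ε hε
  filter_upwards [Metric.tendstoUniformlyOn_iff.1 (hK.2 _ hnull) (ε / 2) (by positivity)] with n hn
  have h1 : ‖dualOperator T (f (φ n) - a)‖ ≤ ε / 2 := by
    refine norm_le_of_hasSum_smul (x := fun m => (f (φ n) - a) (x m)) (fun c => ?_) (by positivity)
      fun m => ?_
    · have := (f (φ n) - a).hasSum (hT c)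
      simp only [map_smul] at this
      exact this
    · have := (hn _ (hx m)).le
      rw [dist_zero_left] at this
      exact this
  rw [dist_eq_norm, Function.comp_apply, ← hfz, ← map_sub]
  linarith

theorem IsRelativelyWeaklyCompact.exists_mapClusterPt {K : Set E}
    (hK : IsRelativelyWeaklyCompact 𝕜 K) {a : ℕ → E} (ha : ∀ n, a n ∈ K) :
    ∃ x : E, MapClusterPt (toWeakSpace 𝕜 E x) atTop fun n => toWeakSpace 𝕜 E (a n) := by
  have hK' : IsCompact (closure (toWeakSpace 𝕜 E '' K)) := hK
  obtain ⟨y, -, hy⟩ := hK'.exists_mapClusterPt_of_frequently (l := (atTop : Filter ℕ))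
    (f := fun n => toWeakSpace 𝕜 E (a n))
    (Eventually.of_forall fun n =>
      subset_closure (Set.mem_image_of_mem (toWeakSpace 𝕜 E) (ha n))).frequently
  obtain ⟨x, rfl⟩ := (toWeakSpace 𝕜 E).surjective y
  exact ⟨x, hy⟩

/-! ### Implications between the five conditions -/

theorem hasPSRStar_of_forall_lp_one [CompleteSpace E] {p : ℝ≥0∞}
    (h : ∀ T : lp (fun _ : ℕ => 𝕜) 1 →L[𝕜] E,
      IsPseudoWeaklyCompactOperator p (dualOperator T) → IsWeaklyCompactOperator T) :
    HasPSRStar 𝕜 p E := by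
  intro K hK
  refine isRelativelyWeaklyCompact_of_mapClusterPt hK.1 fun a ha => ?_
  obtain ⟨C, hC⟩ := hK.1.exists_norm_le
  obtain ⟨T, hT⟩ := exists_clm_lp_one (𝕜 := 𝕜) fun n => hC _ (ha n)
  refine (h T (isPseudoWeaklyCompactOperator_dualOperator hK ha hT)).exists_mapClusterPt
    fun n => ⟨lp.single 1 n 1, ?_, ?_⟩
  · rw [mem_closedBall_zero_iff, lp.norm_single (by simp), norm_one]
  · refine (hT _).unique ?_
    have h1 := hasSum_single (f := fun m => (lp.single 1 n (1 : 𝕜) : lp (fun _ : ℕ => 𝕜) 1) m • a m)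
      n fun m hm => by simp [lp.single_apply, hm]
    simpa using h1

theorem excess_self (K : Set E) : excess K K = 0 := by
  simp +contextual [excess, Metric.infEDist_zero_of_mem]

theorem deBlasi_le_vartheta {p : ℝ≥0∞} (h : HasPSRStar 𝕜 p E) (K : Set E) :
    deBlasi 𝕜 K ≤ vartheta 𝕜 p K := by
  refine le_iInf fun A => le_iInf fun hne => le_iInf fun hA => ?_
  let C : Set (WeakSpace 𝕜 E) := closure (toWeakSpace 𝕜 E '' A)
  let B : Set E := toWeakSpace 𝕜 E ⁻¹' C
  have hAB : A ⊆ B := fun x hx =>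
    (subset_closure ⟨x, hx, rfl⟩ : toWeakSpace 𝕜 E x ∈ C)
  have hB : IsWeaklyCompact 𝕜 B := by
    rw [IsWeaklyCompact, Set.image_preimage_eq _ (toWeakSpace 𝕜 E).surjective]
    exact h A hA
  refine (iInf₂_le_of_le B (hne.mono hAB) (iInf_le _ hB)).trans ?_
  exact iSup₂_mono fun x _ => Metric.infEDist_anti hAB

theorem isWeaklyCompactOperator_of_deBlasi_le [CompleteSpace F] {p : ℝ≥0∞} (hp : 1 ≤ p)
    {T : E →L[𝕜] F} (h : deBlasiOperator T ≤ varthetaOperator p T)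
    (hT : IsPseudoWeaklyCompactOperator p (dualOperator T)) : IsWeaklyCompactOperator T := by
  have hR := isPRightStarSet_image_closedBall hp hT
  refine isRelativelyWeaklyCompact_of_deBlasi_eq_zero hR.1 (le_antisymm (h.trans ?_) zero_le)
  have hne : (T '' Metric.closedBall 0 1).Nonempty :=
    ⟨T 0, 0, Metric.mem_closedBall_self zero_le_one, rfl⟩
  exact (iInf₂_le_of_le _ hne (iInf_le _ hR)).trans (excess_self _).le

end Operators

end RightStar

theorem theorem4p4 {𝕜 : Type} [RCLike 𝕜] (p : ℝ≥0∞) (hp : 1 ≤ p)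
    (X : Type v) [NormedAddCommGroup X] [NormedSpace 𝕜 X] [CompleteSpace X] :
    List.TFAE [
      ∀ (Y : Type w) [NormedAddCommGroup Y] [NormedSpace 𝕜 Y] [CompleteSpace Y] (T : Y →L[𝕜] X),
        IsPseudoWeaklyCompactOperator p (dualOperator T) → IsWeaklyCompactOperator T,
      ∀ T : lp (fun _ : ℕ => 𝕜) 1 →L[𝕜] X,
        IsPseudoWeaklyCompactOperator p (dualOperator T) → IsWeaklyCompactOperator T,
      HasPSRStar 𝕜 p X,
      ∀ (Y : Type w) [NormedAddCommGroup Y] [NormedSpace 𝕜 Y] [CompleteSpace Y] (T : Y →L[𝕜] X),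
        deBlasiOperator T ≤ varthetaOperator p T,
      ∀ K : Set X, Bornology.IsBounded K → deBlasi 𝕜 K ≤ vartheta 𝕜 p K] := by
  tfae_have 1 → 2 := by
    intro h T hT
    -- ℓ₁ lives in the lowest universe, so it is lifted isometrically to the universe of Y.
    let e := (LinearIsometryEquiv.ulift 𝕜 (lp (fun _ : ℕ => 𝕜) 1) :
      ULift.{w} (lp (fun _ : ℕ => 𝕜) 1) ≃ₗᵢ[𝕜] lp (fun _ : ℕ => 𝕜) 1)
    let L : ULift.{w} (lp (fun _ : ℕ => 𝕜) 1) →L[𝕜] lp (fun _ : ℕ => 𝕜) 1 :=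
      e.toContinuousLinearEquiv
    -- By definition (T ∘ L)* = L* ∘ T*.
    have h1 : IsWeaklyCompactOperator (T.comp L) := h _ _ (hT.clm_comp (dualOperator L))
    have h2 : T.comp L '' Metric.closedBall 0 1 = T '' Metric.closedBall 0 1 := by
      have : L '' Metric.closedBall 0 1 = Metric.closedBall 0 1 := by
        have := e.image_closedBall 0 1
        rw [map_zero] at this
        exact this
      rw [← this, Set.image_image]
      rfl
    rwa [IsWeaklyCompactOperator, h2] at h1
  tfae_have 2 → 3 := hasPSRStar_of_forall_lp_one
  tfae_have 3 → 5 := fun h K _ => deBlasi_le_vartheta h K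
  tfae_have 5 → 4 := fun h Y _ _ _ T =>
    h _ (T.lipschitz.isBounded_image Metric.isBounded_closedBall)
  tfae_have 4 → 1 := fun h Y _ _ _ T hT => isWeaklyCompactOperator_of_deBlasi_le hp (h Y T) hT
  tfae_finish
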